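/- For a sequence $(a_n)_{n\ge 1}$ of complex numbers, say that the (possibly divergent) series $\sum_{n\ge1} a_n$ has *ζ-regularized value* $v$ if the Dirichlet series $\sum_{n\ge 1} a_n n^{-t}$ converges absolutely for $\operatorname{Re} t$ large and has a meromorphic continuation to some half-plane $\operatorname{Re} t>-\varepsilon$ ($\varepsilon>0$), holomorphic at $t=0$ with value $v$ there. Let $(l_k)$ be a family of positive reals with zeta function $Z(s)=\sum_k l_k^{-s}$, and let $Z'(s)=\sum_{n\ge 1} f_n(s)$ be an expansion such that $\sum_k l_k^{-s}$ and $\sum_n f_n(s)$ converge absolutely in some right half-plane, with the equality holding there, and such that each $f_n$ is meromorphic on an open right half-plane containing $0$ and holomorphic at $0$. The *ζ-regularized product* $\prod_k l_k$, computed through this expansion, is $e^{-d}$, where $d$ (the regularized value of $Z'(0)$) is the ζ-regularized value of the series $\sum_{n\ge1} f_n(0)$, if this value exists. (When $f_1$ is the only nonzero term, this is the classical $e^{-Z'(0)}$.) Let $P(s)=\sum_p p^{-s}$, the sum being over all primes, let $\mu(n)$ be the Möbius function, let $\gamma$ be the Euler–Mascheroni constant, and put $$\eta=\sum_\rho \frac1{\rho(1-\rho)},\qquad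 \mu = 2+\gamma-\eta,$$ where $\rho$ runs over the nontrivial zeros of $\zeta$ (those with $0<\operatorname{Re}\rho<1$), counted with multiplicity. **Theorem.** 1. The series $\eta$ converges absolutely, $\eta=\gamma+2-\log 4\pi$, and hence $\mu=\log 4\pi$. 2. The ζ-regularized value of $\sum_{n\ge1}\mu(n)$ is $-2$. 3. For $\operatorname{Re}s>1$, $$P'(s)=\sum_{n\ge1}\mu(n)\frac{\zeta'(ns)}{\zeta(ns)}.$$ The series $\sum_{n\ge1}\mu(n)\frac{\zeta'(0)}{\zeta(0)}$ of the values of these terms at $s=0$ has ζ-regularized value $-2\,\frac{\zeta'(0)}{\zeta(0)}=-2\log 2\pi$; this is the regularized value of $P'(0)$. 4. The ζ-regularized product over all primes, computed through the expansion of $P'$ in part 3, exists, is unique, and equals $$\prod_p p=\pi e^{\mu}=4\pi^2 .$$ No analytic continuation of $P$ itself to $s=0$ is asserted or used. -/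

import Mathlib

open scoped ArithmeticFunction.Moebius

noncomputable section

/-- `HasZetaRegSum a v`: the (possibly divergent) series `∑_{n ≥ 1} a n` has the zeta-regularized
value `v`. That is, the Dirichlet series `∑_{n ≥ 1} a n * n ^ (-t)` converges absolutely for
`Re t` large, has a meromorphic continuation `g` to an open right half-plane containing `0`,
`g` is holomorphic at `0`, and `g 0 = v`. -/
def HasZetaRegSum (a : ℕ → ℂ) (v : ℂ) : Prop :=
  ∃ (g : ℂ → ℂ) (σ ε : ℝ), 0 < ε ∧
    (∀ t : ℂ, σ < t.re → LSeriesSummable a t ∧ g t = LSeries a t) ∧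
    MeromorphicOn g {t : ℂ | -ε < t.re} ∧ AnalyticAt ℂ g 0 ∧ g 0 = v

/-- The zeta function `∑_k l_k ^ (-s)` of a family `l` of positive numbers. -/
def familyZeta {ι : Type*} (l : ι → ℝ) (s : ℂ) : ℂ :=
  ∑' k, (l k : ℂ) ^ (-s)

/-- `f 1 + f 2 + ⋯` is an expansion of the derivative of the zeta function of `l`: both series
converge absolutely in some right half-plane, where `(familyZeta l)' = ∑_{n ≥ 1} f n`, and
every `f n` is meromorphic on an open right half-plane containing `0` and holomorphic at `0`. -/
def IsZetaDerivExpansion {ι : Type*} (l : ι → ℝ) (f : ℕ → ℂ → ℂ) : Prop :=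
  (∃ σ : ℝ, ∀ s : ℂ, σ < s.re →
    Summable (fun k => (l k : ℂ) ^ (-s)) ∧
    ∃ d : ℂ, HasDerivAt (familyZeta l) d s ∧ HasSum (fun n : ℕ => f (n + 1) s) d) ∧
  ∀ n : ℕ, 1 ≤ n →
    (∃ ε : ℝ, 0 < ε ∧ MeromorphicOn (f n) {s : ℂ | -ε < s.re}) ∧ AnalyticAt ℂ (f n) 0

/-- `v` is the zeta-regularized product `∏ l_k`, computed through the expansion `f` of the
derivative of the zeta function of `l`: `v = exp (-d)`, where `d` (the regularized value at `0` of
the derivative) is the zeta-regularized value of the series `∑_{n ≥ 1} f n 0`.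
When `f` has the single nonzero term `f 1`, this is the classical definition
`v = exp (-Z' 0)`, with `f 1` the continuation of `Z'`, where `Z = familyZeta l`. -/
def HasZetaRegProd {ι : Type*} (l : ι → ℝ) (f : ℕ → ℂ → ℂ) (v : ℂ) : Prop :=
  (∀ k, 0 < l k) ∧ IsZetaDerivExpansion l f ∧
    ∃ d : ℂ, HasZetaRegSum (fun n => f n 0) d ∧ v = Complex.exp (-d)

/-- The family of all primes. -/
def primeFamily (p : Nat.Primes) : ℝ := ((p : ℕ) : ℝ)

/-- The terms `μ(n) ζ'(n s) / ζ(n s)` of the expansion of the derivative of the prime zeta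
function. -/
def primeZetaDerivTerm (n : ℕ) (s : ℂ) : ℂ :=
  (μ n : ℂ) * (deriv riemannZeta (n * s) / riemannZeta (n * s))

/-- The nontrivial zeros of the Riemann zeta function. -/
def nontrivialZeros : Set ℂ :=
  {ρ : ℂ | riemannZeta ρ = 0 ∧ 0 < ρ.re ∧ ρ.re < 1}

/-- The contribution `m(ρ) / (ρ (1 - ρ))` of a nontrivial zero `ρ` of multiplicity `m(ρ)`. -/
def etaTerm (ρ : nontrivialZeros) : ℂ :=
  (analyticOrderNatAt riemannZeta (ρ : ℂ) : ℂ) / ((ρ : ℂ) * (1 - (ρ : ℂ)))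

/-- `η = ∑_ρ 1 / (ρ (1 - ρ))`, over the nontrivial zeros counted with multiplicity. -/
def etaConst : ℂ := ∑' ρ : nontrivialZeros, etaTerm ρ

/-- The constant `2 + γ - η`. -/
def muConst : ℂ := 2 + (Real.eulerMascheroniConstant : ℂ) - etaConst

end

/-! Two independent computations meet in the final value.

The constant: `riemannXi` is entire, has exactly the nontrivial zeros (with multiplicity), and
equals 1 at 0 and 1. Since 1/(ρ(1-ρ)) = 1/(1-ρ) - 1/(0-ρ), the series η should be ξ'/ξ(1) - ξ'/ξ(0),
which special values of `completedRiemannZeta₀` evaluate. No Hadamard product is needed: after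
division by the zeros in a disc of radius R, Borel-Carathéodory and Cauchy bound the variation of
the remaining logarithmic derivative by M/R² up to a constant, where log|ξ| ≤ M on radius 2R
(`norm_logDeriv_sub_sum_zeros_le`). Growth slower than every exp(εR²) sends this to 0
(`tendsto_sum_etaTerm`). Terms with nonnegative real part upgrade convergence along discs to
absolute convergence (`summable_etaTerm`).

The product: Möbius inversion of -ζ'/ζ = ∑ Λ(n) n^(-s) gives the expansion of P'. At s = 0 its n-th
term is μ(n) times the constant ζ'(0)/ζ(0), and ∑ μ(n) n^(-t) = 1/ζ(t) takes the value -2 at t = 0.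
Hence d = -2 log 2π and exp(-d) = 4π². The identity theorem for meromorphic functions makes d
unique. -/

/-! ### Partial fractions of f'/f for an entire function -/

open Complex Metric Filter Topology in
/-- Dividing an entire function by `(1 - z / a) ^ n`, where `n` is its order of vanishing at
`a ≠ 0`. -/
theorem Differentiable.exists_eq_one_sub_div_pow_mul {f : ℂ → ℂ} (hf : Differentiable ℂ f) {a : ℂ}
    (ha : a ≠ 0) {n : ℕ} (hn : analyticOrderAt f a = n) :
    ∃ g : ℂ → ℂ, Differentiable ℂ g ∧ (∀ z, f z = (1 - z / a) ^ n * g z) ∧ g a ≠ 0 := by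
  obtain ⟨g₀, hg₀, hg₀a, hfg⟩ := (hf.analyticAt a).analyticOrderAt_eq_natCast.1 hn
  let G : ℂ → ℂ := Function.update (fun z => f z / (z - a) ^ n) a (g₀ a)
  have hG : G =ᶠ[𝓝 a] g₀ := by
    filter_upwards [hfg] with z hz
    rcases eq_or_ne z a with rfl | h
    · simp [G]
    · simp only [G, Function.update_of_ne h, hz, smul_eq_mul]
      rw [mul_div_cancel_left₀ _ (pow_ne_zero _ (sub_ne_zero.2 h))]
  have hGd : Differentiable ℂ G := by
    intro z
    rcases eq_or_ne z a with rfl | h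
    · exact hg₀.differentiableAt.congr_of_eventuallyEq hG
    · have : G =ᶠ[𝓝 z] fun z => f z / (z - a) ^ n := by
        filter_upwards [isOpen_ne.mem_nhds h] with w hw
        simp [G, Function.update_of_ne hw]
      refine DifferentiableAt.congr_of_eventuallyEq ?_ this
      exact (hf z).div (by fun_prop) (pow_ne_zero _ (sub_ne_zero.2 h))
  -- The constant converts (z - a)^n into (1 - z/a)^n, a factor equal to 1 at the origin.
  refine ⟨fun z => (-a) ^ n * G z, hGd.const_mul _, fun z => ?_, ?_⟩
  · have h1 : (1 - z / a) ^ n * (-a) ^ n = (z - a) ^ n := by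
      rw [← mul_pow]; congr 1; field_simp; ring
    rw [← mul_assoc, h1]
    rcases eq_or_ne z a with rfl | h
    · simpa [G] using hfg.self_of_nhds
    · simp only [G, Function.update_of_ne h]
      field_simp [sub_ne_zero.2 h]
  · simp [G, ha, hg₀a]

/-- Dividing an entire function by finitely many of its zeros. -/
theorem Differentiable.exists_eq_prod_one_sub_div_pow_mul {f : ℂ → ℂ} (hf : Differentiable ℂ f)
    (hf0 : ∀ a, analyticOrderAt f a ≠ ⊤) (S : Finset ℂ) (hS : (0 : ℂ) ∉ S) :
    ∃ g : ℂ → ℂ, Differentiable ℂ g ∧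
      (∀ z, f z = (∏ a ∈ S, (1 - z / a) ^ analyticOrderNatAt f a) * g z) ∧ ∀ a ∈ S, g a ≠ 0 := by
  induction S using Finset.induction_on with
  | empty => exact ⟨f, hf, by simp, by simp⟩
  | insert a S haS ih =>
    rw [Finset.mem_insert, not_or] at hS
    obtain ⟨g, hg, hfg, hgS⟩ := ih hS.2
    have ha : a ≠ 0 := Ne.symm hS.1
    have hPd : Differentiable ℂ fun z : ℂ => ∏ b ∈ S, (1 - z / b) ^ analyticOrderNatAt f b := by
      fun_prop
    have hPa : (∏ b ∈ S, (1 - a / b) ^ analyticOrderNatAt f b) ≠ 0 := by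
      refine Finset.prod_ne_zero_iff.2 fun b hb => pow_ne_zero _ ?_
      have hb0 : b ≠ 0 := fun h => hS.2 (h ▸ hb)
      have hab : a ≠ b := fun h => haS (h ▸ hb)
      rwa [sub_ne_zero, ne_comm, Ne, div_eq_one_iff_eq hb0]
    have hord : analyticOrderAt g a = (analyticOrderNatAt f a : ℕ) := by
      rw [Nat.cast_analyticOrderNatAt (hf0 a)]
      have : f = (fun z : ℂ => ∏ b ∈ S, (1 - z / b) ^ analyticOrderNatAt f b) * g := funext hfg
      conv_rhs => rw [this]
      rw [analyticOrderAt_mul (hPd.analyticAt a) (hg.analyticAt a),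
        (hPd.analyticAt a).analyticOrderAt_eq_zero.2 hPa, zero_add]
    obtain ⟨g₁, hg₁, hgg₁, hg₁a⟩ := hg.exists_eq_one_sub_div_pow_mul ha hord
    refine ⟨g₁, hg₁, fun z => ?_, fun b hb => ?_⟩
    · rw [Finset.prod_insert haS, hfg z, hgg₁ z]; ring
    · rcases Finset.mem_insert.1 hb with rfl | hb
      · exact hg₁a
      · have := hgS b hb
        rw [hgg₁ b] at this
        exact right_ne_zero_of_mul this

open Metric in
/-- A zero-free holomorphic function on a disc has a holomorphic logarithm. -/
theorem DifferentiableOn.exists_exp_eq_of_ball {g : ℂ → ℂ} {R : ℝ} (hR : 0 < R)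
    (hg : DifferentiableOn ℂ g (ball 0 R)) (hg0 : ∀ z ∈ ball (0 : ℂ) R, g z ≠ 0) (h1 : g 0 = 1) :
    ∃ h : ℂ → ℂ, h 0 = 0 ∧ (∀ z ∈ ball (0 : ℂ) R, HasDerivAt h (logDeriv g z) z) ∧
      ∀ z ∈ ball (0 : ℂ) R, Complex.exp (h z) = g z := by
  have hd : DifferentiableOn ℂ (logDeriv g) (ball 0 R) :=
    (hg.deriv isOpen_ball).div hg hg0
  obtain ⟨h, h0, hh⟩ := hd.isExactOn_ball.with_val_at 0 0
  refine ⟨h, h0, hh, fun z hz => ?_⟩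
  -- With h a primitive of g'/g, the product g·exp(-h) is constant, equal to its value 1 at 0.
  have key : ∀ w ∈ ball (0 : ℂ) R, HasDerivAt (fun w => g w * Complex.exp (-h w)) 0 w := by
    intro w hw
    have h2 := ((hg.differentiableAt (isOpen_ball.mem_nhds hw)).hasDerivAt).mul
      ((hh w hw).neg.cexp)
    convert! h2 using 1
    rw [logDeriv_apply]
    field_simp [hg0 w hw]
    ring
  have := isOpen_ball.is_const_of_deriv_eq_zero (convex_ball (0 : ℂ) R).isPreconnected
    (fun w hw => (key w hw).differentiableAt.differentiableWithinAt)
    (fun w hw => (key w hw).deriv) hz (mem_ball_self hR)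
  simp only [h1, h0, neg_zero, Complex.exp_zero, mul_one] at this
  rw [Complex.exp_neg, mul_inv_eq_one₀ (Complex.exp_ne_zero _)] at this
  exact this.symm

open Metric in
/-- Oscillation of the logarithmic derivative of a zero-free function bounded by `exp M`. -/
theorem norm_logDeriv_sub_logDeriv_le {g : ℂ → ℂ} {R M : ℝ} (hR : 0 < R) (hM : 0 < M)
    (hg : DifferentiableOn ℂ g (ball 0 R)) (hg0 : ∀ z ∈ ball (0 : ℂ) R, g z ≠ 0) (h1 : g 0 = 1)
    (hgM : ∀ z ∈ ball (0 : ℂ) R, ‖g z‖ ≤ Real.exp M) {u v : ℂ}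
    (hu : ‖u‖ ≤ R / 8) (hv : ‖v‖ ≤ R / 8) :
    ‖logDeriv g u - logDeriv g v‖ ≤ 64 * M / R ^ 2 * ‖u - v‖ := by
  obtain ⟨h, h0, hh, hexp⟩ := hg.exists_exp_eq_of_ball hR hg0 h1
  have hhd : DifferentiableOn ℂ h (ball 0 R) :=
    fun z hz => (hh z hz).differentiableAt.differentiableWithinAt
  have hre : Set.MapsTo h (ball 0 R) {z | z.re ≤ M} := by
    intro z hz
    have := hgM z hz
    rw [← hexp z hz, Complex.norm_exp, Real.exp_le_exp] at this
    exact this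
  -- Borel-Carathéodory turns Re h ≤ M into a bound on |h| in radius R/2. Cauchy's estimate on
  -- circles of radius R/4, then R/8, bounds h' by 8M/R and h'' by 64M/R².
  have hb : ∀ z : ℂ, ‖z‖ ≤ R / 2 → ‖h z‖ ≤ 2 * M := by
    intro z hz
    refine (Complex.borelCaratheodory_zero hM hhd hre hR
      (mem_ball_zero_iff.2 (by linarith)) h0).trans ?_
    rw [div_le_iff₀ (by linarith)]
    nlinarith
  have hsub : ∀ c : ℂ, ∀ r : ℝ, 0 < r → ‖c‖ + r < R → closedBall c r ⊆ ball 0 R := by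
    intro c r _ hcr z hz
    rw [mem_closedBall, dist_eq_norm] at hz
    rw [mem_ball_zero_iff]
    calc ‖z‖ = ‖c + (z - c)‖ := by ring_nf
      _ ≤ ‖c‖ + ‖z - c‖ := norm_add_le _ _
      _ < R := by linarith
  have hnear : ∀ c : ℂ, ∀ r : ℝ, ∀ z ∈ sphere c r, ‖z‖ ≤ ‖c‖ + r := by
    intro c r z hz
    rw [mem_sphere, dist_eq_norm] at hz
    calc ‖z‖ = ‖c + (z - c)‖ := by ring_nf
      _ ≤ ‖c‖ + ‖z - c‖ := norm_add_le _ _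
      _ = ‖c‖ + r := by rw [hz]
  have hb' : ∀ z : ℂ, ‖z‖ ≤ R / 4 → ‖logDeriv g z‖ ≤ 8 * M / R := by
    intro z hz
    have hzb : z ∈ ball (0 : ℂ) R := mem_ball_zero_iff.2 (by linarith)
    rw [← (hh z hzb).deriv]
    have := Complex.norm_deriv_le_of_forall_mem_sphere_norm_le (f := h) (c := z) (R := R / 4)
      (C := 2 * M) (by linarith)
      ((hhd.mono (hsub z (R / 4) (by linarith) (by linarith))).diffContOnCl_ball subset_rfl)
      (fun w hw => hb w ((hnear z _ w hw).trans (by linarith)))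
    refine this.trans (le_of_eq ?_)
    field_simp
    norm_num
  have hd : DifferentiableOn ℂ (logDeriv g) (ball 0 R) :=
    (hg.deriv isOpen_ball).div hg hg0
  have hb'' : ∀ z ∈ closedBall (0 : ℂ) (R / 8), ‖deriv (logDeriv g) z‖ ≤ 64 * M / R ^ 2 := by
    intro z hz
    rw [mem_closedBall_zero_iff] at hz
    have := Complex.norm_deriv_le_of_forall_mem_sphere_norm_le (f := logDeriv g) (c := z)
      (R := R / 8) (C := 8 * M / R) (by linarith)
      ((hd.mono (hsub z (R / 8) (by linarith) (by linarith))).diffContOnCl_ball subset_rfl)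
      (fun w hw => hb' w ((hnear z _ w hw).trans (by linarith)))
    refine this.trans (le_of_eq ?_)
    field_simp
    norm_num
  refine (convex_closedBall (0 : ℂ) (R / 8)).norm_image_sub_le_of_norm_deriv_le (fun z hz => ?_)
    hb'' (mem_closedBall_zero_iff.2 hv) (mem_closedBall_zero_iff.2 hu)
  refine hd.differentiableAt (isOpen_ball.mem_nhds (mem_ball_zero_iff.2 ?_))
  rw [mem_closedBall_zero_iff] at hz
  linarith

open Metric in
/-- The partial fraction expansion of `f' / f` over the zeros in a disc of radius `R`, with an
error term controlled by the growth of `f` in the disc of radius `2 * R`. -/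
theorem norm_logDeriv_sub_sum_zeros_le {f : ℂ → ℂ} (hf : Differentiable ℂ f) (hf1 : f 0 = 1)
    {R M : ℝ} (hR : 0 < R) (hM : 0 < M)
    (hfM : ∀ z : ℂ, ‖z‖ ≤ 2 * R → ‖f z‖ ≤ Real.exp M) (S : Finset ℂ)
    (hS : ∀ a, a ∈ S ↔ f a = 0 ∧ ‖a‖ ≤ R) {u v : ℂ} (hu : ‖u‖ ≤ R / 8) (hv : ‖v‖ ≤ R / 8)
    (hfu : f u ≠ 0) (hfv : f v ≠ 0) :
    ‖(logDeriv f u - logDeriv f v) -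
      ∑ a ∈ S, (analyticOrderNatAt f a : ℂ) * (1 / (u - a) - 1 / (v - a))‖ ≤
        64 * M / R ^ 2 * ‖u - v‖ := by
  have hne : f ≠ 0 := fun h => by simp [h] at hf1
  have hord : ∀ a, analyticOrderAt f a ≠ ⊤ := fun a h => by
    rw [AnalyticOnNhd.analyticOrderAt_eq_top_iff_eq_zero a (fun z => hf.analyticAt z)] at h
    exact hne h
  have hS0 : (0 : ℂ) ∉ S := fun h => by simp [(hS 0).1 h] at hf1
  obtain ⟨g, hg, hfg, hgS⟩ := hf.exists_eq_prod_one_sub_div_pow_mul hord S hS0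
  have hg1 : g 0 = 1 := by have := hfg 0; simp_all
  have hg0 : ∀ z ∈ ball (0 : ℂ) R, g z ≠ 0 := by
    intro z hz h
    have hzS : z ∈ S := (hS z).2 ⟨by rw [hfg z, h, mul_zero], (mem_ball_zero_iff.1 hz).le⟩
    exact hgS z hzS h
  -- On the circle of radius 2R, |z/a| ≥ 2 for each removed zero, so every factor has modulus at
  -- least 1 and |g| ≤ |f|. The maximum principle carries the bound inside.
  have hbd : ∀ z : ℂ, ‖z‖ = 2 * R → ‖g z‖ ≤ Real.exp M := by
    intro z hz
    have h1 : 1 ≤ ‖∏ a ∈ S, (1 - z / a) ^ analyticOrderNatAt f a‖ := by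
      rw [norm_prod]
      refine Finset.prod_induction _ (1 ≤ ·) (fun _ _ => one_le_mul_of_one_le_of_one_le) le_rfl
        fun a ha => ?_
      rw [norm_pow]
      refine one_le_pow₀ ?_
      have ha0 : 0 < ‖a‖ := norm_pos_iff.2 fun h => hS0 (h ▸ ha)
      have h2 : 2 ≤ ‖z / a‖ := by
        rw [norm_div, hz, le_div_iff₀ ha0]
        linarith [((hS a).1 ha).2]
      have h3 := norm_sub_norm_le (z / a) 1
      rw [norm_one, norm_sub_rev] at h3
      linarith
    have h2 := hfM z hz.le
    rw [hfg z, norm_mul] at h2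
    exact (le_mul_of_one_le_left (norm_nonneg _) h1).trans h2
  have hgM : ∀ z ∈ ball (0 : ℂ) R, ‖g z‖ ≤ Real.exp M := by
    intro z hz
    have h2R : (2 * R) ≠ 0 := by positivity
    refine Complex.norm_le_of_forall_mem_frontier_norm_le (U := ball 0 (2 * R)) isBounded_ball
      hg.diffContOnCl (fun w hw => hbd w ?_) (subset_closure (ball_subset_ball (by linarith) hz))
    rw [frontier_ball _ h2R] at hw
    simpa using hw
  have hlog : ∀ w : ℂ, ‖w‖ ≤ R / 8 → f w ≠ 0 → logDeriv g w =
      logDeriv f w - ∑ a ∈ S, (analyticOrderNatAt f a : ℂ) * (1 / (w - a)) := by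
    intro w hw hfw
    have hfac : ∀ a ∈ S, (1 - w / a) ^ analyticOrderNatAt f a ≠ 0 := by
      have : (∏ a ∈ S, (1 - w / a) ^ analyticOrderNatAt f a) ≠ 0 := by
        rw [hfg w] at hfw
        exact left_ne_zero_of_mul hfw
      exact Finset.prod_ne_zero_iff.1 this
    have hfun : f = fun z => (∏ a ∈ S, (1 - z / a) ^ analyticOrderNatAt f a) * g z := funext hfg
    have hgw : g w ≠ 0 := by rw [hfg w] at hfw; exact right_ne_zero_of_mul hfw
    have h1 : logDeriv f w =
        logDeriv (fun z => ∏ a ∈ S, (1 - z / a) ^ analyticOrderNatAt f a) w + logDeriv g w := by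
      conv_lhs => rw [hfun]
      exact logDeriv_mul w (Finset.prod_ne_zero_iff.2 hfac) hgw (by fun_prop) (hg w)
    have h2 : logDeriv (fun z => ∏ a ∈ S, (1 - z / a) ^ analyticOrderNatAt f a) w =
        ∑ a ∈ S, (analyticOrderNatAt f a : ℂ) * (1 / (w - a)) := by
      rw [logDeriv_prod hfac (fun a _ => by fun_prop)]
      refine Finset.sum_congr rfl fun a ha => ?_
      have ha0 : a ≠ 0 := fun h => hS0 (h ▸ ha)
      have hwa : w - a ≠ 0 := fun h => by
        rw [sub_eq_zero.1 h] at hfw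
        exact hfw ((hS a).1 ha).1
      rw [logDeriv_fun_pow (by fun_prop)]
      congr 1
      have hd : HasDerivAt (fun z : ℂ => 1 - z / a) (-(1 / a)) w :=
        ((hasDerivAt_id w).div_const a).const_sub 1
      rw [logDeriv_apply, hd.deriv]
      have : 1 - w / a = -(w - a) / a := by field_simp; ring
      rw [this]
      field_simp
    rw [h1, h2]
    ring
  have := norm_logDeriv_sub_logDeriv_le hR hM hg.differentiableOn hg0 hg1 hgM hu hv
  rw [hlog u hu hfu, hlog v hv hfv] at this
  convert! this using 2
  simp only [mul_sub, Finset.sum_sub_distrib]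
  ring

/-! ### Growth of the completed zeta function -/

open Set Filter Topology MeasureTheory in
/-- Growth in a right half-plane of the entire function `Λ₀` of a weak FE-pair whose kernel decays
exponentially. -/
theorem WeakFEPair.exists_norm_Λ₀_le (P : WeakFEPair ℂ) {p : ℝ} (hp : 0 < p)
    (hO : (fun x => P.f x - P.f₀) =O[atTop] fun x : ℝ => Real.exp (-p * x)) :
    ∃ c K : ℝ, 1 ≤ c ∧ 1 ≤ K ∧ ∀ (N : ℕ) (s : ℂ), 0 ≤ s.re → s.re ≤ N + 1 →
      ‖P.Λ₀ s‖ ≤ c * K ^ (N + 1) * N.factorial := by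
  have hmc : MellinConvergent P.f_modif 0 :=
    mellinConvergent_of_isBigO_rpow P.hf_modif_int
      (P.isStrongFEPair_toStrongFEPair.hf_top (-1)) (by simp)
      (P.isStrongFEPair_toStrongFEPair.hf_zero (-(-1))) (by simp)
  obtain ⟨C, hC0, hC⟩ := hO.exists_pos
  obtain ⟨T₀, hT₀⟩ := eventually_atTop.1 hC.bound
  -- Beyond 1 the modified kernel is `P.f - P.f₀`, the function that decays exponentially.
  set T := max T₀ 1 with hT
  have hT1 : 1 ≤ T := le_max_right _ _
  have hTb : ∀ x, T < x → ‖P.f_modif x‖ ≤ C * Real.exp (-p * x) := by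
    intro x hx
    have h1 : 1 < x := hT1.trans_lt hx
    have := hT₀ x ((le_max_left _ _).trans hx.le)
    rw [Real.norm_of_nonneg (Real.exp_pos _).le] at this
    simpa [WeakFEPair.f_modif, h1, h1.le] using this
  have hA : IntegrableOn (fun x : ℝ => x⁻¹ * ‖P.f_modif x‖) (Ioi 0) := by
    refine IntegrableOn.congr_fun hmc.norm (fun x (hx : 0 < x) => ?_) measurableSet_Ioi
    simp [Complex.norm_cpow_eq_rpow_re_of_pos hx, Real.rpow_neg_one]
  have hB : IntegrableOn (fun x : ℝ => Real.exp (-(p / 2) * x)) (Ioi 0) :=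
    integrableOn_exp_mul_Ioi (by linarith) 0
  set A := ∫ x in Ioi (0 : ℝ), x⁻¹ * ‖P.f_modif x‖ with hAdef
  set D := ∫ x in Ioi (0 : ℝ), Real.exp (-(p / 2) * x) with hDdef
  have hA0 : 0 ≤ A := setIntegral_nonneg measurableSet_Ioi
    fun x (hx : 0 < x) => by positivity
  have hD0 : 0 ≤ D := setIntegral_nonneg measurableSet_Ioi fun x _ => (Real.exp_pos _).le
  refine ⟨A + C * D + 1, T + 2 / p, by nlinarith [mul_nonneg hC0.le hD0],
    by linarith [show 0 < 2 / p by positivity], fun N s hs0 hsN => ?_⟩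
  have hpt : ∀ x ∈ Ioi (0 : ℝ), ‖(x : ℂ) ^ (s - 1) • P.f_modif x‖ ≤
      T ^ (N + 1) * (x⁻¹ * ‖P.f_modif x‖) +
        C * (N.factorial * (2 / p) ^ N) * Real.exp (-(p / 2) * x) := by
    intro x hx
    have hx0 : 0 < x := hx
    rw [norm_smul, Complex.norm_cpow_eq_rpow_re_of_pos hx0, Complex.sub_re, Complex.one_re]
    have hxp : x ^ (s.re - 1) = x ^ s.re * x⁻¹ := by
      rw [Real.rpow_sub_one hx0.ne', div_eq_mul_inv]
    -- Below T the power x^s costs at most T^(N+1). Above T, half of the exponential decay absorbs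
    -- x^N through one term of the exponential series, at the price N!(2/p)^N.
    rcases le_or_gt x T with hxT | hxT
    · have h1 : x ^ s.re ≤ T ^ (N + 1) := by
        calc x ^ s.re ≤ T ^ s.re := Real.rpow_le_rpow hx0.le hxT hs0
          _ ≤ T ^ ((N + 1 : ℕ) : ℝ) :=
            Real.rpow_le_rpow_of_exponent_le hT1 (by push_cast; exact hsN)
          _ = T ^ (N + 1) := Real.rpow_natCast _ _
      rw [hxp, mul_assoc]
      have h2 : 0 ≤ C * (N.factorial * (2 / p) ^ N) * Real.exp (-(p / 2) * x) := by positivity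
      have h3 := mul_le_mul_of_nonneg_right h1
        (show 0 ≤ x⁻¹ * ‖P.f_modif x‖ by positivity)
      linarith
    · have hx1 : 1 ≤ x := hT1.trans hxT.le
      have h1 : x ^ (s.re - 1) ≤ x ^ N := by
        rw [← Real.rpow_natCast]
        exact Real.rpow_le_rpow_of_exponent_le hx1 (by linarith)
      have h2 : x ^ N ≤ N.factorial * (2 / p) ^ N * Real.exp (p / 2 * x) := by
        have h3 := Real.pow_div_factorial_le_exp (p / 2 * x) (by positivity) N
        rw [div_le_iff₀ (by positivity), mul_pow] at h3
        have h4 : x ^ N = (2 / p) ^ N * ((p / 2) ^ N * x ^ N) := by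
          rw [← mul_assoc, ← mul_pow]
          field_simp
          simp
        rw [h4]
        calc _ ≤ (2 / p) ^ N * (Real.exp (p / 2 * x) * N.factorial) := by gcongr
          _ = _ := by ring
      have h5 : Real.exp (p / 2 * x) * Real.exp (-p * x) = Real.exp (-(p / 2) * x) := by
        rw [← Real.exp_add]; ring_nf
      calc x ^ (s.re - 1) * ‖P.f_modif x‖
          ≤ (N.factorial * (2 / p) ^ N * Real.exp (p / 2 * x)) * (C * Real.exp (-p * x)) :=
            mul_le_mul (h1.trans h2) (hTb x hxT) (norm_nonneg _) (by positivity)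
        _ = C * (N.factorial * (2 / p) ^ N) * (Real.exp (p / 2 * x) * Real.exp (-p * x)) := by ring
        _ = C * (N.factorial * (2 / p) ^ N) * Real.exp (-(p / 2) * x) := by rw [h5]
        _ ≤ _ := le_add_of_nonneg_left (by positivity)
  have hint : ‖P.Λ₀ s‖ ≤ T ^ (N + 1) * A + C * (N.factorial * (2 / p) ^ N) * D := by
    have h1 := norm_integral_le_of_norm_le ((hA.const_mul (T ^ (N + 1))).add
      (hB.const_mul (C * (N.factorial * (2 / p) ^ N))))
      ((ae_restrict_iff' measurableSet_Ioi).2 (Eventually.of_forall hpt))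
    refine h1.trans (le_of_eq ?_)
    simp only [Pi.add_apply]
    rw [integral_add (hA.const_mul _) (hB.const_mul _), integral_const_mul, integral_const_mul]
  have hq : 0 < 2 / p := by positivity
  have hfac : (1 : ℝ) ≤ N.factorial := by exact_mod_cast N.factorial_pos
  have e1 : T ^ (N + 1) ≤ (T + 2 / p) ^ (N + 1) := by gcongr; linarith
  have e2 : (2 / p) ^ N ≤ (T + 2 / p) ^ (N + 1) := by
    calc (2 / p) ^ N ≤ (T + 2 / p) ^ N := by gcongr; linarith
      _ ≤ _ := pow_le_pow_right₀ (by linarith) (Nat.le_succ N)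
  have e0 : 0 ≤ (T + 2 / p) ^ (N + 1) := by positivity
  calc ‖P.Λ₀ s‖ ≤ T ^ (N + 1) * A + C * (N.factorial * (2 / p) ^ N) * D := hint
    _ ≤ (T + 2 / p) ^ (N + 1) * A * N.factorial
        + C * (N.factorial * (T + 2 / p) ^ (N + 1)) * D := by
      refine add_le_add ?_ (by gcongr)
      calc T ^ (N + 1) * A ≤ (T + 2 / p) ^ (N + 1) * A := by gcongr
        _ ≤ _ := le_mul_of_one_le_right (by positivity) hfac
    _ ≤ (A + C * D + 1) * (T + 2 / p) ^ (N + 1) * N.factorial := by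
      have : 0 ≤ (T + 2 / p) ^ (N + 1) * N.factorial := by positivity
      nlinarith

/-! ### The xi function: growth, functional equation, zeros -/

/-- The Riemann xi function, normalized so that `riemannXi 0 = riemannXi 1 = 1`. -/
noncomputable def riemannXi (s : ℂ) : ℂ := 1 - s * (1 - s) * completedRiemannZeta₀ s

-- The theta kernel minus its limit decays exponentially, so the Mellin bound applies for Re s ≥ 0;
-- the symmetry s ↦ 1 - s covers the rest. The reflected point may have real part N + 1, hence that
-- range in the Mellin bound.
open Filter in
theorem exists_norm_completedRiemannZeta₀_le :
    ∃ c K : ℝ, 1 ≤ c ∧ 1 ≤ K ∧ ∀ (N : ℕ) (s : ℂ), ‖s‖ ≤ N →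
      ‖completedRiemannZeta₀ s‖ ≤ c * K ^ (N + 1) * N.factorial := by
  obtain ⟨p, hp, hO⟩ := HurwitzZeta.isBigO_atTop_evenKernel_sub 0
  have hO' : (fun x => (HurwitzZeta.hurwitzEvenFEPair 0).f x - (HurwitzZeta.hurwitzEvenFEPair 0).f₀)
      =O[atTop] fun x : ℝ => Real.exp (-p * x) := by
    rw [← Asymptotics.isBigO_norm_left] at hO ⊢
    refine hO.congr_left fun x => ?_
    simp only [HurwitzZeta.hurwitzEvenFEPair, if_true, Function.comp_apply]
    rw [← Complex.ofReal_one, ← Complex.ofReal_sub, Complex.norm_real]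
  obtain ⟨c, K, hc, hK, h⟩ := WeakFEPair.exists_norm_Λ₀_le _ hp hO'
  have hright : ∀ (N : ℕ) (s : ℂ), 0 ≤ s.re → s.re ≤ N + 1 →
      ‖completedRiemannZeta₀ s‖ ≤ c * K ^ (N + 1) * N.factorial := by
    intro N s h0 hN
    have h2 : ((s / 2 : ℂ)).re = s.re / 2 := by simp
    have := h N (s / 2) (by rw [h2]; linarith) (by rw [h2]; linarith)
    rw [completedRiemannZeta₀, HurwitzZeta.completedHurwitzZetaEven₀, norm_div]
    simp only [Complex.norm_ofNat]
    linarith [norm_nonneg ((HurwitzZeta.hurwitzEvenFEPair 0).Λ₀ (s / 2))]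
  refine ⟨c, K, hc, hK, fun N s hs => ?_⟩
  have h1 := (abs_le.1 (Complex.abs_re_le_norm s))
  rcases le_total 0 s.re with h0 | h0
  · exact hright N s h0 (by linarith)
  · rw [← completedRiemannZeta₀_one_sub]
    refine hright N _ ?_ ?_ <;> rw [Complex.sub_re, Complex.one_re] <;> linarith

open Filter in
/-- The function `riemannXi` has order at most `1`; this is the weaker statement that it grows
slower than a Gaussian. -/
theorem eventually_norm_riemannXi_le {ε : ℝ} (hε : 0 < ε) :
    ∀ᶠ R : ℝ in atTop, ∀ s : ℂ, ‖s‖ ≤ R → ‖riemannXi s‖ ≤ Real.exp (ε * R ^ 2) := by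
  obtain ⟨c, K, hc, hK, h⟩ := exists_norm_completedRiemannZeta₀_le
  have hlog : ∀ᶠ R : ℝ in atTop, Real.log (R + 1) ≤ ε / 8 * (R + 1) := by
    have := (Real.isLittleO_log_id_atTop.bound (show 0 < ε / 8 by positivity))
    filter_upwards [(tendsto_atTop_add_const_right atTop (1 : ℝ) tendsto_id).eventually this,
      eventually_ge_atTop 0] with R hR hR0
    simp only [id, Real.norm_eq_abs] at hR
    rw [abs_of_nonneg (show 0 ≤ R + 1 by linarith)] at hR
    exact (le_abs_self _).trans hR
  have hc0 : 0 ≤ Real.log c := Real.log_nonneg hc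
  have hK0 : 0 ≤ Real.log K := Real.log_nonneg hK
  filter_upwards [hlog, eventually_ge_atTop 1,
    eventually_ge_atTop (2 * (2 + Real.log c + 3 * Real.log K) / ε)] with R hR1 hR hR2 s hs
  set N := ⌈R⌉₊ with hN
  have hRN : R ≤ N := Nat.le_ceil R
  have hNR : (N : ℝ) ≤ R + 1 := (Nat.ceil_lt_add_one (by linarith)).le
  have h1 := h N s (hs.trans hRN)
  -- This is c·K^(R+2)·(R+1)^(R+1), which dominates the factorial bound because N ≤ R + 1 and N! ≤
  -- N^N.
  set X := Real.exp (Real.log c + (R + 2) * Real.log K + (R + 1) * Real.log (R + 1)) with hX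
  have hX1 : 1 ≤ X := by
    refine Real.one_le_exp ?_
    have : 0 ≤ Real.log (R + 1) := Real.log_nonneg (by linarith)
    positivity
  have hle : c * K ^ (N + 1) * N.factorial ≤ X := by
    rw [hX, Real.exp_add, Real.exp_add, Real.exp_log (by linarith)]
    have e1 : K ^ (N + 1) ≤ Real.exp ((R + 2) * Real.log K) := by
      rw [mul_comm, ← Real.rpow_def_of_pos (by linarith), ← Real.rpow_natCast]
      exact Real.rpow_le_rpow_of_exponent_le hK (by push_cast; linarith)
    have e2 : (N.factorial : ℝ) ≤ Real.exp ((R + 1) * Real.log (R + 1)) := by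
      rw [mul_comm, ← Real.rpow_def_of_pos (by linarith)]
      calc (N.factorial : ℝ) ≤ (N : ℝ) ^ N := by exact_mod_cast Nat.factorial_le_pow N
        _ ≤ (R + 1) ^ N := by gcongr
        _ = (R + 1) ^ (N : ℝ) := (Real.rpow_natCast _ _).symm
        _ ≤ _ := Real.rpow_le_rpow_of_exponent_le (by linarith) hNR
    gcongr
  have h2 : ‖riemannXi s‖ ≤ 1 + R * (1 + R) * X := by
    have h3 : ‖(1 : ℂ) - s‖ ≤ 1 + R := (norm_sub_le _ _).trans (by rw [norm_one]; linarith)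
    refine (norm_sub_le _ _).trans ?_
    rw [norm_one, norm_mul, norm_mul]
    gcongr
    exact h1.trans hle
  have h4 : 1 + R * (1 + R) * X ≤ Real.exp (2 * R) * X := by
    have := Real.quadratic_le_exp_of_nonneg (show 0 ≤ 2 * R by linarith)
    nlinarith
  refine h2.trans (h4.trans ?_)
  rw [hX, ← Real.exp_add, Real.exp_le_exp]
  -- The linear part of the exponent and (R+1) log(R+1) each take at most εR²/2.
  rw [div_le_iff₀ hε] at hR2
  have h5 : (R + 1) * Real.log (R + 1) ≤ (R + 1) * (ε / 8 * (R + 1)) := by gcongr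
  have h6 : 2 * R + (Real.log c + (R + 2) * Real.log K) ≤
      R * (2 + Real.log c + 3 * Real.log K) := by nlinarith
  have h7 : R * (2 * (2 + Real.log c + 3 * Real.log K)) ≤ R * (R * ε) := by gcongr
  have h8 : (R + 1) * (ε / 8 * (R + 1)) ≤ ε / 2 * R ^ 2 := by
    have : (R + 1) ^ 2 ≤ 4 * R ^ 2 := by nlinarith
    nlinarith
  nlinarith

theorem differentiable_riemannXi : Differentiable ℂ riemannXi := by
  have := differentiable_completedZeta₀
  unfold riemannXi
  fun_prop

@[simp] theorem riemannXi_zero : riemannXi 0 = 1 := by simp [riemannXi]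

@[simp] theorem riemannXi_one : riemannXi 1 = 1 := by simp [riemannXi]

theorem riemannXi_one_sub (s : ℂ) : riemannXi (1 - s) = riemannXi s := by
  simp only [riemannXi, completedRiemannZeta₀_one_sub]
  ring

theorem riemannXi_eq_mul_completedRiemannZeta {s : ℂ} (h0 : s ≠ 0) (h1 : s ≠ 1) :
    riemannXi s = -(s * (1 - s)) * completedRiemannZeta s := by
  have : 1 - s ≠ 0 := sub_ne_zero.2 h1.symm
  rw [completedRiemannZeta_eq, riemannXi]
  field_simp
  ring

theorem riemannZeta_eq_mul_riemannXi {s : ℂ} (h0 : s ≠ 0) (h1 : s ≠ 1) :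
    riemannZeta s = -((Complex.Gammaℝ s)⁻¹ / (s * (1 - s))) * riemannXi s := by
  have : 1 - s ≠ 0 := sub_ne_zero.2 h1.symm
  rw [riemannZeta_def_of_ne_zero h0, riemannXi_eq_mul_completedRiemannZeta h0 h1]
  field_simp

/-- Nonvanishing of ζ on Re s ≥ 1 excludes zeros of ξ there, and the functional equation excludes Re
s ≤ 0. Inside the strip the factor relating ζ and ξ has no zero. -/
theorem riemannXi_eq_zero_iff {s : ℂ} : riemannXi s = 0 ↔ s ∈ nontrivialZeros := by
  constructor
  · intro h
    have h0 : s ≠ 0 := by rintro rfl; simp at h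
    have h1 : s ≠ 1 := by rintro rfl; simp at h
    have hlt : ∀ w : ℂ, riemannXi w = 0 → w.re < 1 := by
      intro w hw
      by_contra! hre
      have hw0 : w ≠ 0 := by rintro rfl; simp at hw
      have hw1 : w ≠ 1 := by rintro rfl; simp at hw
      have := riemannZeta_eq_mul_riemannXi hw0 hw1
      rw [hw, mul_zero] at this
      exact riemannZeta_ne_zero_of_one_le_re hre this
    refine ⟨by rw [riemannZeta_eq_mul_riemannXi h0 h1, h, mul_zero], ?_, hlt s h⟩
    have := hlt (1 - s) (by rw [riemannXi_one_sub, h])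
    rw [Complex.sub_re, Complex.one_re] at this
    linarith
  · rintro ⟨hz, hpos, hlt⟩
    have h0 : s ≠ 0 := by rintro rfl; simp at hpos
    have h1 : s ≠ 1 := by rintro rfl; simp at hlt
    rw [riemannZeta_eq_mul_riemannXi h0 h1] at hz
    refine (mul_eq_zero.1 hz).resolve_left (neg_ne_zero.2 (div_ne_zero
      (inv_ne_zero (Complex.Gammaℝ_ne_zero_of_re_pos hpos))
      (mul_ne_zero h0 (sub_ne_zero.2 h1.symm))))

open Filter Topology in
theorem analyticOrderAt_riemannXi {ρ : ℂ} (hρ : ρ ∈ nontrivialZeros) :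
    analyticOrderAt riemannXi ρ = analyticOrderAt riemannZeta ρ := by
  obtain ⟨-, hpos, hlt⟩ := hρ
  have h0 : ρ ≠ 0 := by rintro rfl; simp at hpos
  have h1 : ρ ≠ 1 := by rintro rfl; simp at hlt
  have h2 : ρ * (1 - ρ) ≠ 0 := mul_ne_zero h0 (sub_ne_zero.2 h1.symm)
  have hev : riemannZeta =ᶠ[𝓝 ρ]
      (fun s => -((Complex.Gammaℝ s)⁻¹ / (s * (1 - s)))) * riemannXi := by
    filter_upwards [isOpen_ne.mem_nhds h0, isOpen_ne.mem_nhds h1] with s hs0 hs1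
    exact riemannZeta_eq_mul_riemannXi hs0 hs1
  have ha : AnalyticAt ℂ (fun s => -((Complex.Gammaℝ s)⁻¹ / (s * (1 - s)))) ρ :=
    ((Complex.differentiable_Gammaℝ_inv.analyticAt ρ).div (by fun_prop) h2).neg
  rw [analyticOrderAt_congr hev, analyticOrderAt_mul ha (differentiable_riemannXi.analyticAt ρ),
    ha.analyticOrderAt_eq_zero.2, zero_add]
  exact neg_ne_zero.2 (div_ne_zero (inv_ne_zero (Complex.Gammaℝ_ne_zero_of_re_pos hpos)) h2)

/-- The derivative of s(1-s) is 1 at 0 and -1 at 1, so the difference is Λ₀(1) + Λ₀(0), both values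
being known. -/
theorem logDeriv_riemannXi_one_sub_logDeriv_riemannXi_zero :
    logDeriv riemannXi 1 - logDeriv riemannXi 0 =
      ((Real.eulerMascheroniConstant + 2 - Real.log (4 * Real.pi) : ℝ) : ℂ) := by
  have hd : ∀ s, HasDerivAt riemannXi (-((1 * (1 - s) + s * (-1)) * completedRiemannZeta₀ s +
      s * (1 - s) * deriv completedRiemannZeta₀ s)) s := fun s =>
    ((((hasDerivAt_id s).mul ((hasDerivAt_id s).const_sub 1)).mul
      (differentiable_completedZeta₀ s).hasDerivAt).const_sub 1)
  have hpi : (4 * (Real.pi : ℂ)) = ((4 * Real.pi : ℝ) : ℂ) := by push_cast; ring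
  rw [logDeriv_apply, logDeriv_apply, (hd 1).deriv, (hd 0).deriv, completedRiemannZeta₀_one,
    completedRiemannZeta₀_zero, hpi, ← Complex.ofReal_log (by positivity)]
  push_cast
  simp
  ring

/-! ### The sum over the nontrivial zeros -/

theorem isCompact_inter_nontrivialZeros_finite {K : Set ℂ} (hK : IsCompact K) :
    {ρ : nontrivialZeros | (ρ : ℂ) ∈ K}.Finite := by
  refine Set.Finite.of_finite_image (f := Subtype.val) (hK.inter_riemannZetaZeros_finite.subset ?_)
    Subtype.val_injective.injOn
  rintro _ ⟨ρ, hρ, rfl⟩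
  exact ⟨hρ, ρ.2.1⟩

/-- The nontrivial zeros of absolute value at most `R`. -/
noncomputable def nontrivialZerosBelow (R : ℝ) : Finset nontrivialZeros :=
  (isCompact_inter_nontrivialZeros_finite (isCompact_closedBall (0 : ℂ) R)).toFinset

theorem mem_nontrivialZerosBelow {R : ℝ} {ρ : nontrivialZeros} :
    ρ ∈ nontrivialZerosBelow R ↔ ‖(ρ : ℂ)‖ ≤ R := by
  simp [nontrivialZerosBelow]

open Filter in
theorem tendsto_nontrivialZerosBelow : Tendsto nontrivialZerosBelow atTop atTop := by
  refine tendsto_atTop_finset_of_monotone (fun R R' h ρ hρ => ?_)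
    fun ρ => ⟨‖(ρ : ℂ)‖, mem_nontrivialZerosBelow.2 le_rfl⟩
  exact mem_nontrivialZerosBelow.2 ((mem_nontrivialZerosBelow.1 hρ).trans h)

/-- This is the contribution of ρ to the partial fraction expansion with u = 1 and v = 0. -/
theorem etaTerm_eq (ρ : nontrivialZeros) :
    etaTerm ρ = (analyticOrderNatAt riemannXi (ρ : ℂ) : ℂ) *
      (1 / (1 - (ρ : ℂ)) - 1 / (0 - (ρ : ℂ))) := by
  obtain ⟨ρ, hρ⟩ := ρ
  have h0 : ρ ≠ 0 := by rintro rfl; simpa using hρ.2.1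
  have h1 : 1 - ρ ≠ 0 := sub_ne_zero.2 (by rintro rfl; simpa using hρ.2.2)
  simp only [etaTerm, analyticOrderNatAt, analyticOrderAt_riemannXi hρ]
  rw [zero_sub]
  field_simp
  ring

open Filter Topology in
theorem tendsto_sum_etaTerm :
    Tendsto (fun R => ∑ ρ ∈ nontrivialZerosBelow R, etaTerm ρ) atTop
      (𝓝 (logDeriv riemannXi 1 - logDeriv riemannXi 0)) := by
  rw [Metric.tendsto_nhds]
  intro ε hε
  -- The error is 64·(ε/512)·(2R)²/R² = ε/2; R ≥ 8 puts the point 1 within R/8.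
  have hgrow := eventually_norm_riemannXi_le (show 0 < ε / 512 by positivity)
  have h2 : Tendsto (fun R : ℝ => 2 * R) atTop atTop := tendsto_id.const_mul_atTop two_pos
  filter_upwards [h2.eventually hgrow, eventually_ge_atTop 8] with R hR hR8
  have hS : ∀ a, a ∈ (nontrivialZerosBelow R).map (Function.Embedding.subtype _) ↔
      riemannXi a = 0 ∧ ‖a‖ ≤ R := by
    intro a
    simp [riemannXi_eq_zero_iff, mem_nontrivialZerosBelow, and_comm]
  have hR0 : 0 < R := by linarith
  have := norm_logDeriv_sub_sum_zeros_le differentiable_riemannXi riemannXi_zero (R := R)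
    hR0 (by positivity) hR _ hS (u := 1) (v := 0)
    (by rw [norm_one]; linarith) (by rw [norm_zero]; linarith) (by simp) (by simp)
  rw [Finset.sum_map] at this
  simp only [Function.Embedding.subtype_apply, ← etaTerm_eq, sub_zero, norm_one, mul_one] at this
  rw [dist_comm, dist_eq_norm]
  refine this.trans_lt ?_
  have : 64 * (ε / 512 * (2 * R) ^ 2) / R ^ 2 = ε / 2 := by
    field_simp
    norm_num
  linarith

theorem mul_one_sub_re_pos (ρ : nontrivialZeros) : 0 < ((ρ : ℂ) * (1 - ρ)).re := by
  obtain ⟨ρ, -, h0, h1⟩ := ρ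
  simp
  nlinarith [sq_nonneg ρ.im, mul_pos h0 (sub_pos.2 h1)]

theorem re_etaTerm (ρ : nontrivialZeros) :
    (etaTerm ρ).re = analyticOrderNatAt riemannZeta (ρ : ℂ) *
      (((ρ : ℂ) * (1 - ρ)).re / ‖(ρ : ℂ) * (1 - ρ)‖ ^ 2) := by
  rw [etaTerm, div_eq_mul_inv, ← Complex.ofReal_natCast, Complex.re_ofReal_mul, Complex.inv_re,
    Complex.normSq_eq_norm_sq]

theorem re_etaTerm_nonneg (ρ : nontrivialZeros) : 0 ≤ (etaTerm ρ).re := by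
  rw [re_etaTerm]
  have := mul_one_sub_re_pos ρ
  positivity

/-- Write w = ρ(1-ρ) and ρ = β + it. Then |Im w| = |t||1-2β| ≤ t² ≤ Re w, so |w| ≤ 2 Re w, and the
same comparison passes to 1/w. -/
theorem norm_etaTerm_le {ρ : nontrivialZeros} (hρ : 1 ≤ |(ρ : ℂ).im|) :
    ‖etaTerm ρ‖ ≤ 2 * (etaTerm ρ).re := by
  have hpos := mul_one_sub_re_pos ρ
  rw [re_etaTerm, etaTerm, norm_div, Complex.norm_natCast]
  have hw0 : 0 < ‖(ρ : ℂ) * (1 - ρ)‖ := hpos.trans_le (Complex.re_le_norm _)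
  have hw : ‖(ρ : ℂ) * (1 - ρ)‖ ≤ 2 * ((ρ : ℂ) * (1 - ρ)).re := by
    have him : |((ρ : ℂ) * (1 - ρ)).im| ≤ ((ρ : ℂ) * (1 - ρ)).re := by
      have h0 := ρ.2.2.1
      have h1 := ρ.2.2.2
      clear hpos hw0
      generalize (ρ : ℂ) = ρ at *
      have e1 : (ρ * (1 - ρ)).im = ρ.im * (1 - 2 * ρ.re) := by simp; ring
      have e2 : (ρ * (1 - ρ)).re = ρ.re * (1 - ρ.re) + |ρ.im| * |ρ.im| := by
        rw [abs_mul_abs_self]; simp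
      rw [e1, e2, abs_mul]
      have h3 : |1 - 2 * ρ.re| ≤ 1 := abs_le.2 ⟨by linarith, by linarith⟩
      have h4 : |ρ.im| * |1 - 2 * ρ.re| ≤ |ρ.im| * |ρ.im| :=
        mul_le_mul_of_nonneg_left (h3.trans hρ) (abs_nonneg _)
      nlinarith
    have := Complex.norm_le_abs_re_add_abs_im ((ρ : ℂ) * (1 - ρ))
    rw [abs_of_pos hpos] at this
    linarith
  rw [mul_left_comm, div_eq_mul_inv]
  gcongr
  rw [← mul_div_assoc, le_div_iff₀ (by positivity)]
  calc _ = ‖(ρ : ℂ) * (1 - ρ)‖ := by field_simp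
    _ ≤ _ := hw

-- Any finite sum of the nonnegative real parts is bounded by the limit along discs, so the real
-- parts are summable. They dominate the norms for all but the finitely many zeros with |Im ρ| < 1.
open Filter Topology in
theorem summable_etaTerm : Summable etaTerm := by
  have hre : Summable fun ρ => (etaTerm ρ).re := by
    refine summable_of_sum_le re_etaTerm_nonneg
      (c := (logDeriv riemannXi 1 - logDeriv riemannXi 0).re) fun s => ?_
    refine ge_of_tendsto ((Complex.continuous_re.tendsto _).comp tendsto_sum_etaTerm) ?_
    filter_upwards [tendsto_nontrivialZerosBelow.eventually_ge_atTop s] with R hR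
    rw [Function.comp_apply, Complex.re_sum]
    exact Finset.sum_le_sum_of_subset_of_nonneg hR fun ρ _ _ => re_etaTerm_nonneg ρ
  refine Summable.of_norm_bounded_eventually (hre.mul_left 2) ?_
  rw [eventually_cofinite]
  refine (isCompact_inter_nontrivialZeros_finite (isCompact_closedBall (0 : ℂ) 2)).subset ?_
  intro ρ hρ
  have him : |(ρ : ℂ).im| < 1 := by
    by_contra! h
    exact hρ (norm_etaTerm_le h)
  have h1 := Complex.norm_le_abs_re_add_abs_im (ρ : ℂ)
  have h2 := ρ.2.2
  rw [abs_of_pos h2.1] at h1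
  simp only [Set.mem_ofPred_eq, mem_closedBall_zero_iff]
  linarith

theorem etaConst_eq :
    etaConst = ((Real.eulerMascheroniConstant + 2 - Real.log (4 * Real.pi) : ℝ) : ℂ) := by
  rw [← logDeriv_riemannXi_one_sub_logDeriv_riemannXi_zero]
  exact tendsto_nhds_unique
    (summable_etaTerm.hasSum.comp tendsto_nontrivialZerosBelow) tendsto_sum_etaTerm

theorem muConst_eq : muConst = ((Real.log (4 * Real.pi) : ℝ) : ℂ) := by
  rw [muConst, etaConst_eq]
  push_cast
  ring

/-! ### Regularized sums and the terms at s = 0 -/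

/-- Two continuations agree far to the right. Infinite order of vanishing of their difference
propagates through the connected half-plane to 0, where continuity recovers the value. -/
theorem HasZetaRegSum.unique {a : ℕ → ℂ} {v w : ℂ} (hv : HasZetaRegSum a v)
    (hw : HasZetaRegSum a w) : v = w := by
  obtain ⟨g, σ, ε, hε, hg, hgm, hga, rfl⟩ := hv
  obtain ⟨g', σ', ε', hε', hg', hgm', hga', rfl⟩ := hw
  set U : Set ℂ := {t | -min ε ε' < t.re} with hU
  have hUm : MeromorphicOn (g - g') U := by
    intro t ht
    have ht' : -min ε ε' < t.re := ht
    refine (hgm t ?_).sub (hgm' t ?_)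
    · exact (neg_le_neg (min_le_left _ _)).trans_lt ht'
    · exact (neg_le_neg (min_le_right _ _)).trans_lt ht'
  have hUp : IsPreconnected U := (convex_halfSpace_re_gt _).isPreconnected
  have h0U : (0 : ℂ) ∈ U := by simp [hU, hε, hε']
  obtain ⟨x, hx⟩ := exists_gt (max (max σ σ') 0)
  simp only [max_lt_iff] at hx
  have hxU : (x : ℂ) ∈ U := by
    have : 0 < min ε ε' := lt_min hε hε'
    simp only [hU, Set.mem_ofPred_eq, Complex.ofReal_re]
    linarith
  have hxt : meromorphicOrderAt (g - g') x = ⊤ := by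
    rw [meromorphicOrderAt_eq_top_iff]
    refine Filter.Eventually.filter_mono nhdsWithin_le_nhds ?_
    have hopen : IsOpen {t : ℂ | max σ σ' < t.re} :=
      isOpen_lt continuous_const Complex.continuous_re
    filter_upwards [hopen.mem_nhds (show max σ σ' < (x : ℂ).re by simpa using hx.1)] with t ht
    have ht' := max_lt_iff.1 (show max σ σ' < t.re from ht)
    rw [Pi.sub_apply, (hg t ht'.1).2, (hg' t ht'.2).2, sub_self]
  have h0t : meromorphicOrderAt (g - g') 0 = ⊤ := by
    by_contra h
    exact hUm.meromorphicOrderAt_ne_top_of_isPreconnected hUp h0U hxU h hxt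
  rw [meromorphicOrderAt_eq_top_iff] at h0t
  have hc : ContinuousAt (g - g') 0 := (hga.sub hga').continuousAt
  have h1 := tendsto_nhds_unique (hc.tendsto.mono_left nhdsWithin_le_nhds)
    (tendsto_const_nhds.congr' (h0t.mono fun _ h => h.symm))
  exact sub_eq_zero.1 h1

theorem HasZetaRegSum.mul_const {a : ℕ → ℂ} {v : ℂ} (hv : HasZetaRegSum a v) (c : ℂ) :
    HasZetaRegSum (fun n => a n * c) (v * c) := by
  obtain ⟨g, σ, ε, hε, hg, hgm, hga, rfl⟩ := hv
  have hfun : (fun n => a n * c) = c • a := by ext n; simp [mul_comm]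
  refine ⟨fun t => g t * c, σ, ε, hε, fun t ht => ⟨?_, ?_⟩,
    fun t ht => (hgm t ht).mul (MeromorphicAt.const c t), hga.mul analyticAt_const, rfl⟩
  · rw [hfun]
    exact (hg t ht).1.smul c
  · rw [hfun, LSeries_smul, ← (hg t ht).2]
    exact mul_comm _ _

theorem meromorphicAt_riemannZeta (s : ℂ) : MeromorphicAt riemannZeta s := by
  have h : MeromorphicAt (fun s => (s - 1)⁻¹ * riemannZeta₁ s) s :=
    (MeromorphicAt.inv (by fun_prop)).mul (differentiable_riemannZeta₁.analyticAt s).meromorphicAt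
  refine h.congr ?_
  have : ∀ᶠ z in nhdsWithin s {s}ᶜ, z ≠ 1 := by
    rcases eq_or_ne s 1 with rfl | hs
    · exact self_mem_nhdsWithin
    · exact nhdsWithin_le_nhds (isOpen_ne.mem_nhds hs)
  filter_upwards [this] with z hz
  exact (riemannZeta_eq_inv_sub_mul hz).symm

theorem analyticAt_riemannZeta {s : ℂ} (hs : s ≠ 1) : AnalyticAt ℂ riemannZeta s :=
  analyticOn_riemannZeta s hs

/-- The continuation is 1/ζ, and ζ(0) = -1/2. -/
theorem hasZetaRegSum_moebius :
    HasZetaRegSum (fun n => (ArithmeticFunction.moebius n : ℂ)) (-2) := by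
  refine ⟨riemannZeta⁻¹, 1, 1, one_pos, fun t ht => ⟨?_, ?_⟩,
    fun t _ => (meromorphicAt_riemannZeta t).inv, ?_, ?_⟩
  · exact ArithmeticFunction.LSeriesSummable_moebius_iff.2 ht
  · have := ArithmeticFunction.LSeries_zeta_mul_Lseries_moebius ht
    rw [ArithmeticFunction.LSeries_zeta_eq_riemannZeta ht] at this
    rw [Pi.inv_apply]
    exact (eq_inv_of_mul_eq_one_right this).symm
  · exact (analyticAt_riemannZeta zero_ne_one).inv (by rw [riemannZeta_zero]; norm_num)
  · rw [Pi.inv_apply, riemannZeta_zero]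
    norm_num

theorem hasZetaRegSum_primeZetaDerivTerm_zero :
    HasZetaRegSum (fun n => primeZetaDerivTerm n 0)
      (-2 * (deriv riemannZeta 0 / riemannZeta 0)) := by
  simpa [primeZetaDerivTerm] using
    hasZetaRegSum_moebius.mul_const (deriv riemannZeta 0 / riemannZeta 0)

theorem neg_two_mul_logDeriv_riemannZeta_zero :
    -2 * (deriv riemannZeta 0 / riemannZeta 0) = ((-2 * Real.log (2 * Real.pi) : ℝ) : ℂ) := by
  have hpi : (2 * (Real.pi : ℂ)) = ((2 * Real.pi : ℝ) : ℂ) := by push_cast; ring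
  rw [deriv_riemannZeta_zero, riemannZeta_zero, hpi, ← Complex.ofReal_log (by positivity)]
  push_cast
  ring

theorem meromorphicAt_primeZetaDerivTerm (n : ℕ) (s : ℂ) :
    MeromorphicAt (primeZetaDerivTerm n) s := by
  rcases Nat.eq_zero_or_pos n with rfl | hn
  · have : primeZetaDerivTerm 0 = fun _ => 0 := by ext; simp [primeZetaDerivTerm]
    rw [this]
    exact MeromorphicAt.const 0 s
  have hlin : AnalyticAt ℂ (fun s : ℂ => (n : ℂ) * s) s := by fun_prop
  have hne : deriv (fun s : ℂ => (n : ℂ) * s) s ≠ 0 := by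
    rw [deriv_const_mul_field]
    simpa using hn.ne'
  have hcomp : ∀ {F : ℂ → ℂ}, MeromorphicAt F (n * s) →
      MeromorphicAt (fun s => F (n * s)) s := fun hF => hF.comp_analyticAt hlin
  exact (MeromorphicAt.const _ s).mul ((hcomp (meromorphicAt_riemannZeta _).deriv).div
    (hcomp (meromorphicAt_riemannZeta _)))

theorem analyticAt_primeZetaDerivTerm_zero (n : ℕ) : AnalyticAt ℂ (primeZetaDerivTerm n) 0 := by
  have hz : AnalyticAt ℂ riemannZeta (n * 0) := by
    rw [mul_zero]; exact analyticAt_riemannZeta zero_ne_one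
  have hlin : AnalyticAt ℂ (fun s : ℂ => (n : ℂ) * s) 0 := by fun_prop
  refine analyticAt_const.mul ((hz.deriv.comp hlin).div (hz.comp hlin) ?_)
  simp [riemannZeta_zero]

/-! ### Möbius inversion for the prime zeta function -/

/-- The Lambert series of the Möbius function. -/
theorem hasSum_moebius_mul_pow {x : ℂ} (hx : ‖x‖ < 1) :
    HasSum (fun q : ℕ × ℕ => (μ (q.1 + 1) : ℂ) * x ^ ((q.1 + 1) * (q.2 + 1))) x := by
  let F : ℕ+ × ℕ+ → ℂ := fun q => (μ (q.1 : ℕ) : ℂ) * x ^ ((q.1 : ℕ) * (q.2 : ℕ))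
  have hsum : Summable F := by
    have h0 := (summable_prod_mul_pow (𝕜 := ℂ) 0 hx).norm
    refine Summable.of_norm_bounded h0 fun q => ?_
    have hμ : ‖(μ (q.1 : ℕ) : ℂ)‖ ≤ 1 := by
      rw [Complex.norm_intCast]
      exact_mod_cast ArithmeticFunction.abs_moebius_le_one
    simp only [F, norm_mul, pow_zero, one_mul]
    exact mul_le_of_le_one_left (norm_nonneg _) hμ |>.trans (le_of_eq (by simp))
  have hsig : HasSum (F ∘ sigmaAntidiagonalEquivProd) (∑' q, F q) :=
    (Equiv.hasSum_iff _).2 hsum.hasSum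
  -- Pairs are grouped by their product N; the divisor sum of μ leaves only N = 1.
  have hfib : ∀ N : ℕ+, HasSum (fun d : Nat.divisorsAntidiagonal N =>
      (F ∘ sigmaAntidiagonalEquivProd) ⟨N, d⟩) (if N = 1 then x else 0) := by
    intro N
    have h1 : ∀ d : Nat.divisorsAntidiagonal N, (F ∘ sigmaAntidiagonalEquivProd) ⟨N, d⟩ =
        (μ d.1.1 : ℂ) * x ^ (N : ℕ) := by
      rintro ⟨d, hd⟩
      have := (Nat.mem_divisorsAntidiagonal.1 hd).1
      simp [F, sigmaAntidiagonalEquivProd, divisorsAntidiagonalFactors, this]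
    simp_rw [h1]
    convert hasSum_fintype (fun d : Nat.divisorsAntidiagonal N => (μ d.1.1 : ℂ) * x ^ (N : ℕ))
      using 1
    rw [Finset.sum_coe_sort (Nat.divisorsAntidiagonal N)
      (fun d => (μ d.1 : ℂ) * x ^ (N : ℕ)), ← Finset.sum_mul,
      Nat.sum_divisorsAntidiagonal (f := fun a _ => (μ a : ℂ)), ← Int.cast_sum]
    have h2 : ∑ a ∈ Nat.divisors N, μ a = if (N : ℕ) = 1 then 1 else 0 := by
      rw [← ArithmeticFunction.coe_mul_zeta_apply, ArithmeticFunction.moebius_mul_coe_zeta,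
        ArithmeticFunction.one_apply]
    rw [h2]
    rcases eq_or_ne N 1 with rfl | hN
    · simp
    · simp [hN]
  have htot := hsig.sigma hfib
  have heq : ∑' q, F q = x := htot.unique (hasSum_ite_eq 1 x)
  rw [heq] at hsig
  have := (Equiv.hasSum_iff (Equiv.prodCongr Equiv.pnatEquivNat.symm Equiv.pnatEquivNat.symm)).2
    ((Equiv.hasSum_iff _).1 hsig)
  convert this using 1
  ext q
  simp [F]

/-- Dirichlet series supported on the primes. -/
theorem LSeriesHasSum_prime_iff (b : ℕ → ℂ) (s v : ℂ) :
    LSeriesHasSum (fun n => if n.Prime then b n else 0) s v ↔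
      HasSum (fun p : Nat.Primes => b p * ((p : ℕ) : ℂ) ^ (-s)) v := by
  have hsupp : Function.support (LSeries.term (fun n => if n.Prime then b n else 0) s) ⊆
      {n | n.Prime} := by
    intro n hn
    by_contra h
    have h' : ¬ n.Prime := h
    simp [LSeries.term, h'] at hn
  rw [LSeriesHasSum, ← hasSum_subtype_iff_of_support_subset hsupp]
  refine Iff.of_eq (congrArg (fun F => HasSum F v) (funext fun p => ?_))
  have hp : (p : ℕ).Prime := p.2
  rw [Function.comp_apply, LSeries.term_of_ne_zero hp.ne_zero, if_pos hp, Complex.cpow_neg,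
    div_eq_mul_inv]

/-- Read as the L-series of the indicator of the primes, whose abscissa is at most 1, the sum can be
differentiated term by term. -/
theorem hasSum_familyZeta_primeFamily {s : ℂ} (hs : 1 < s.re) :
    HasSum (fun p => (primeFamily p : ℂ) ^ (-s)) (familyZeta primeFamily s) ∧
      ∃ d, HasDerivAt (familyZeta primeFamily) d s ∧
        HasSum (fun p : Nat.Primes => -Complex.log p * ((p : ℕ) : ℂ) ^ (-s)) d := by
  let a : ℕ → ℂ := fun n => if n.Prime then 1 else 0
  have habs : LSeries.abscissaOfAbsConv a ≤ 1 :=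
    LSeries.abscissaOfAbsConv_le_of_le_const ⟨1, fun n _ => by
      by_cases h : n.Prime <;> simp [a, h]⟩
  have hlt : ∀ z : ℂ, 1 < z.re → LSeries.abscissaOfAbsConv a < z.re := fun z hz =>
    habs.trans_lt (by exact_mod_cast hz)
  have hfam : ∀ z : ℂ, 1 < z.re →
      HasSum (fun p => (primeFamily p : ℂ) ^ (-z)) (LSeries a z) := by
    intro z hz
    have := (LSeriesHasSum_prime_iff (fun _ => 1) z _).1
      (LSeriesSummable_of_abscissaOfAbsConv_lt_re (hlt z hz)).LSeriesHasSum
    simpa [primeFamily] using this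
  have heq : ∀ z : ℂ, 1 < z.re → familyZeta primeFamily z = LSeries a z := fun z hz =>
    (hfam z hz).tsum_eq
  refine ⟨heq s hs ▸ hfam s hs, -LSeries (LSeries.logMul a) s, ?_, ?_⟩
  · refine (LSeries_hasDerivAt (hlt s hs)).congr_of_eventuallyEq ?_
    filter_upwards [(isOpen_lt continuous_const Complex.continuous_re).mem_nhds hs] with z hz
    exact heq z hz
  · have h1 : LSeries.logMul a = fun n => if n.Prime then Complex.log n else 0 := by
      ext n
      by_cases h : n.Prime <;> simp [LSeries.logMul, a, h]
    have h2 := (LSeriesSummable_logMul_of_lt_re (hlt s hs)).LSeriesHasSum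
    rw [h1] at h2 ⊢
    simpa using ((LSeriesHasSum_prime_iff (fun n => Complex.log n) s _).1 h2).neg

/-- The logarithmic derivative of `ζ` as a sum over prime powers. -/
theorem hasSum_deriv_riemannZeta_div_riemannZeta {s : ℂ} (hs : 1 < s.re) :
    HasSum (fun q : Nat.Primes × ℕ => -Complex.log q.1 * ((q.1 : ℕ) : ℂ) ^ (-(s * (q.2 + 1))))
      (deriv riemannZeta s / riemannZeta s) := by
  have h := (ArithmeticFunction.LSeriesSummable_vonMangoldt hs).LSeriesHasSum
  rw [ArithmeticFunction.LSeries_vonMangoldt_eq_deriv_riemannZeta_div hs, LSeriesHasSum] at h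
  have hsupp : Function.support (LSeries.term (fun n => (ArithmeticFunction.vonMangoldt n : ℂ)) s) ⊆
      {n | IsPrimePow n} := by
    intro n hn
    by_contra h'
    rw [Set.mem_ofPred_eq, ← ArithmeticFunction.vonMangoldt_eq_zero_iff] at h'
    simp [LSeries.term, h'] at hn
  rw [← hasSum_subtype_iff_of_support_subset hsupp] at h
  -- Prime powers are parametrized by (p, k) ↦ p^(k+1), and Λ takes the value log p there.
  have h2 := ((Nat.Primes.prodNatEquiv.hasSum_iff
    (f := fun n : {n : ℕ // IsPrimePow n} =>
      LSeries.term (fun n => (ArithmeticFunction.vonMangoldt n : ℂ)) s n)).2 h).neg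
  rw [neg_div, neg_neg] at h2
  convert! h2 using 1
  ext ⟨p, k⟩
  have hp := p.2
  rw [Function.comp_apply, Nat.Primes.coe_prodNatEquiv_apply,
    LSeries.term_of_ne_zero (pow_ne_zero _ hp.ne_zero),
    ArithmeticFunction.vonMangoldt_apply_pow k.succ_ne_zero,
    ArithmeticFunction.vonMangoldt_apply_prime hp, Complex.natCast_log, Complex.cpow_neg,
    div_eq_mul_inv, neg_mul]
  congr 3
  push_cast
  rw [← Complex.natCast_cpow_natCast_mul, mul_comm]
  push_cast
  rfl

/-- Möbius inversion for double series: if `∑ c i * x i` converges absolutely to `d` and every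
`‖x i‖ ≤ 1 / 2`, then so does the triple series `∑ c i * (μ n * x i ^ (n * k))`. -/
theorem HasSum.moebius_mul_pow {ι : Type*} {c x : ι → ℂ} {d : ℂ} (hx : ∀ i, ‖x i‖ ≤ 1 / 2)
    (h : HasSum (fun i => c i * x i) d) :
    HasSum (fun q : ℕ × (ι × ℕ) =>
      c q.2.1 * ((μ (q.1 + 1) : ℂ) * x q.2.1 ^ ((q.1 + 1) * (q.2.2 + 1)))) d := by
  obtain ⟨G, hGdef⟩ : ∃ G : ι × (ℕ × ℕ) → ℂ, ∀ i n k, G (i, n, k) =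
      c i * ((μ (n + 1) : ℂ) * x i ^ ((n + 1) * (k + 1))) :=
    ⟨fun q => c q.1 * ((μ (q.2.1 + 1) : ℂ) * x q.1 ^ ((q.2.1 + 1) * (q.2.2 + 1))),
      fun _ _ _ => rfl⟩
  have hG : Summable G := by
    have hgeo : Summable fun n : ℕ => ((1 : ℝ) / 2) ^ n := summable_geometric_two
    have h1 : Summable fun q : ι × (ℕ × ℕ) =>
        ‖c q.1 * x q.1‖ * ((1 / 2 : ℝ) ^ q.2.1 * (1 / 2 : ℝ) ^ q.2.2) :=
      h.summable.norm.mul_of_nonneg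
        (hgeo.mul_of_nonneg hgeo (fun _ => by positivity) fun _ => by positivity)
        (fun _ => norm_nonneg _) fun _ => by positivity
    refine Summable.of_norm_bounded h1 ?_
    rintro ⟨p, n, k⟩
    have hμ : ‖(μ (n + 1) : ℂ)‖ ≤ 1 := by
      rw [Complex.norm_intCast]
      exact_mod_cast ArithmeticFunction.abs_moebius_le_one
    -- One factor of x is kept to pair with c; the remaining n + k + nk factors give geometric decay
    -- in n and k.
    have hpow : ‖x p‖ ^ ((n + 1) * (k + 1)) ≤ ‖x p‖ * ((1 / 2 : ℝ) ^ n * (1 / 2 : ℝ) ^ k) := by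
      rw [show (n + 1) * (k + 1) = 1 + (n + k + n * k) by ring, pow_add, pow_one, ← pow_add]
      gcongr ‖x p‖ * ?_
      calc ‖x p‖ ^ (n + k + n * k) ≤ (1 / 2 : ℝ) ^ (n + k + n * k) := by gcongr; exact hx p
        _ ≤ (1 / 2 : ℝ) ^ (n + k) :=
          pow_le_pow_of_le_one (by norm_num) (by norm_num) (Nat.le_add_right _ _)
    calc ‖G (p, n, k)‖ = ‖c p‖ * (‖(μ (n + 1) : ℂ)‖ * ‖x p‖ ^ ((n + 1) * (k + 1))) := by
          rw [hGdef, norm_mul, norm_mul, norm_pow]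
      _ ≤ ‖c p‖ * (1 * (‖x p‖ * ((1 / 2 : ℝ) ^ n * (1 / 2 : ℝ) ^ k))) := by
          refine mul_le_mul_of_nonneg_left ?_ (norm_nonneg _)
          exact mul_le_mul hμ hpow (by positivity) zero_le_one
      _ = ‖c p * x p‖ * ((1 / 2 : ℝ) ^ n * (1 / 2 : ℝ) ^ k) := by
          rw [norm_mul, one_mul, mul_assoc]
  have hGp : ∀ i, HasSum (fun q => G (i, q)) (c i * x i) := by
    intro i
    have hi : ‖x i‖ < 1 := (hx i).trans_lt (by norm_num)
    exact ((hasSum_moebius_mul_pow hi).mul_left (c i)).congr_fun fun q => hGdef i q.1 q.2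
  have hGd : HasSum G d := by
    rw [← (hG.hasSum.prod_fiberwise hGp).unique h]
    exact hG.hasSum
  let e : ℕ × (ι × ℕ) ≃ ι × (ℕ × ℕ) :=
    { toFun := fun q => (q.2.1, q.1, q.2.2)
      invFun := fun q => (q.2.1, q.1, q.2.2)
      left_inv := fun _ => rfl
      right_inv := fun _ => rfl }
  exact (e.hasSum_iff.2 hGd).congr_fun fun q => (hGdef q.2.1 q.1 q.2.2).symm

theorem Nat.Primes.norm_cpow_neg_le {s : ℂ} (hs : 1 < s.re) (p : Nat.Primes) :
    ‖((p : ℕ) : ℂ) ^ (-s)‖ ≤ 1 / 2 := by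
  have hp' : (2 : ℝ) ≤ (p : ℕ) := by exact_mod_cast p.2.two_le
  rw [Complex.norm_natCast_cpow_of_pos p.2.pos, Complex.neg_re]
  calc ((p : ℕ) : ℝ) ^ (-s.re) ≤ ((p : ℕ) : ℝ) ^ (-1 : ℝ) :=
        Real.rpow_le_rpow_of_exponent_le (by linarith) (by linarith)
    _ = (((p : ℕ) : ℝ))⁻¹ := Real.rpow_neg_one _
    _ ≤ 1 / 2 := by
      rw [one_div]
      gcongr

/-- Take x_p = p^(-s) and c_p = -log p in the triple series. Summing over p and k first, for fixed
n, reproduces μ(n) ζ'(ns)/ζ(ns). -/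
theorem hasDerivAt_familyZeta_primeFamily {s : ℂ} (hs : 1 < s.re) :
    ∃ d, HasDerivAt (familyZeta primeFamily) d s ∧
      HasSum (fun n : ℕ => primeZetaDerivTerm (n + 1) s) d := by
  obtain ⟨-, d, hd, hsum⟩ := hasSum_familyZeta_primeFamily hs
  refine ⟨d, hd, ?_⟩
  refine (hsum.moebius_mul_pow (Nat.Primes.norm_cpow_neg_le hs)).prod_fiberwise fun n => ?_
  have hns : 1 < (((n + 1 : ℕ) : ℂ) * s).re := by
    rw [← Complex.ofReal_natCast, Complex.re_ofReal_mul]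
    push_cast
    nlinarith [(Nat.cast_nonneg n : (0 : ℝ) ≤ n)]
  have h := (hasSum_deriv_riemannZeta_div_riemannZeta hns).mul_left (μ (n + 1) : ℂ)
  refine h.congr_fun fun q => ?_
  have hxp : (((q.1 : ℕ) : ℂ) ^ (-s)) ^ ((n + 1) * (q.2 + 1)) =
      ((q.1 : ℕ) : ℂ) ^ (-(((n + 1 : ℕ) : ℂ) * s * (q.2 + 1))) := by
    rw [← Complex.cpow_nat_mul]
    congr 1
    push_cast
    ring
  rw [hxp, mul_left_comm]

/-! ### The regularized product over the primes -/

theorem isZetaDerivExpansion_primeZetaDerivTerm :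
    IsZetaDerivExpansion primeFamily primeZetaDerivTerm :=
  ⟨⟨1, fun _ hs => ⟨(hasSum_familyZeta_primeFamily hs).1.summable,
    hasDerivAt_familyZeta_primeFamily hs⟩⟩,
    fun n _ => ⟨⟨1, one_pos, fun s _ => meromorphicAt_primeZetaDerivTerm n s⟩,
      analyticAt_primeZetaDerivTerm_zero n⟩⟩

theorem pi_mul_exp_muConst :
    (Real.pi : ℂ) * Complex.exp muConst = 4 * (Real.pi : ℂ) ^ 2 := by
  rw [muConst_eq, ← Complex.ofReal_exp, Real.exp_log (by positivity)]
  push_cast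
  ring

theorem exp_neg_regularized_deriv_primeZeta :
    Complex.exp (-(-2 * (deriv riemannZeta 0 / riemannZeta 0))) =
      (Real.pi : ℂ) * Complex.exp muConst := by
  rw [pi_mul_exp_muConst, neg_two_mul_logDeriv_riemannZeta_zero, ← Complex.ofReal_neg,
    ← Complex.ofReal_exp, neg_mul, neg_neg, two_mul, Real.exp_add, Real.exp_log (by positivity)]
  push_cast
  ring

theorem hasZetaRegProd_primeFamily_iff (v : ℂ) :
    HasZetaRegProd primeFamily primeZetaDerivTerm v ↔
      v = (Real.pi : ℂ) * Complex.exp muConst := by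
  rw [← exp_neg_regularized_deriv_primeZeta]
  constructor
  · rintro ⟨-, -, d, hd, rfl⟩
    rw [hd.unique hasZetaRegSum_primeZetaDerivTerm_zero]
  · rintro rfl
    exact ⟨fun p => by simpa [primeFamily] using p.2.pos, isZetaDerivExpansion_primeZetaDerivTerm,
      _, hasZetaRegSum_primeZetaDerivTerm_zero, rfl⟩

theorem mainTheorem1 :
    (Summable etaTerm ∧
      etaConst =
        ((Real.eulerMascheroniConstant + 2 - Real.log (4 * Real.pi) : ℝ) : ℂ)) ∧
    muConst = ((Real.log (4 * Real.pi) : ℝ) : ℂ) ∧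
    HasZetaRegSum (fun n => (ArithmeticFunction.moebius n : ℂ)) (-2) ∧
    -2 * (deriv riemannZeta 0 / riemannZeta 0) =
        ((-2 * Real.log (2 * Real.pi) : ℝ) : ℂ) ∧
    HasZetaRegSum (fun n => primeZetaDerivTerm n 0)
        (-2 * (deriv riemannZeta 0 / riemannZeta 0)) ∧
    (∀ s : ℂ, 1 < s.re →
      HasDerivAt (familyZeta primeFamily)
        (∑' n : ℕ, primeZetaDerivTerm (n + 1) s) s) ∧
    (∀ v : ℂ, HasZetaRegProd primeFamily primeZetaDerivTerm v ↔
      v = (Real.pi : ℂ) * Complex.exp muConst) ∧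
    (Real.pi : ℂ) * Complex.exp muConst = 4 * (Real.pi : ℂ) ^ 2 := by
  refine ⟨⟨summable_etaTerm, etaConst_eq⟩, muConst_eq, hasZetaRegSum_moebius,
    neg_two_mul_logDeriv_riemannZeta_zero, hasZetaRegSum_primeZetaDerivTerm_zero, fun s hs => ?_,
    hasZetaRegProd_primeFamily_iff, pi_mul_exp_muConst⟩
  obtain ⟨d, hd, hsum⟩ := hasDerivAt_familyZeta_primeFamily hs
  rwa [hsum.tsum_eq]
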